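/- **Theorem 1.3 (properness of the $G_T$-action on weakly stable maps).** Let $T$ be a finite tree; a vertex is *unstable* if its valence is at most $2$. Fix a minimal stabilization $\hat T=(T,L)$: a labelling $L:\{1,\dots,n\}\to T$ of the vertices by marked points such that valence plus number of labels is $3$ at each unstable vertex and stable vertices carry no labels. A stable curve modelled on $\hat T$ consists of a copy $\Sigma_v={\bf CP}^1$ for each vertex $v$, with distinct special points: a double point $d_{vu}$ for each edge $[vu]$ and a marked point for each label at $v$; three chosen special points on each $\Sigma_v$ are at $0,1,\infty$ (the choice depends only on $\hat T$). Let $M$ be a Riemannian manifold (only its smooth structure matters), and let $k\in{\bf N}$, $1\le p<\infty$ with $k-2/p\ge 1$. Let $\tilde{\mathcal B}^{\hat T}$ be the space of pairs $(\Sigma,f)$ where $\Sigma$ is a stable curve modelled on $\hat T$ and $f=\{f_v:\Sigma_v\to M\}_{v\in T}$ is a family of continuous maps of Sobolev class $L^p_k$ with $f_v(d_{vu})=f_u(d_{uv})$ for each edge $[vu]$. It is topologized as a subspace of the product of the spaces of positions of the special points and of the spaces of $L_k^p$-maps ${\bf CP}^1\to M$ with the $L_k^p$-topology. Let $\tilde{\mathcal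 B}^{ws}_{\hat T}\subset \tilde{\mathcal B}^{\hat T}$ be the subspace of *weakly stable* maps, those for which no $f_v$ with $v$ unstable is constant. For an unstable vertex $v$ let $G_v\subset {\bf PSL}(2,{\bf C})$ be the group of automorphisms of $\Sigma_v$ that fix its double points (whose positions depend only on $\hat T$), and let the Lie group $G_T=\prod_{v\ \mathrm{unstable}}G_v$ act on $\tilde{\mathcal B}^{ws}_{\hat T}$ by reparametrization: $g\cdot(\Sigma,f)=(\Sigma, f\circ g)$, with $g$ acting as the identity on the components with $v$ stable. Then the action of $G_T$ on $\tilde{\mathcal B}^{ws}_{\hat T}$ is proper in the following sense: for any $f_1,f_2\in\tilde{\mathcal B}^{ws}_{\hat T}$ there exist open neighbourhoods $U_1\ni f_1$ and $U_2\ni f_2$ in $\tilde{\mathcal B}^{ws}_{\hat T}$ and compact subsets $K_1,K_2\subset G_T$ such that $g_1\cdot h_1\notin U_2$ for all $h_1\in U_1$ and $g_1\in G_T\setminus K_1$, and $g_2\cdot h_2\notin U_1$ for all $h_2\in U_2$ and $g_2\in G_T\setminus K_2$. -/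

import Mathlib

open scoped Manifold ContDiff LinearAlgebra.Projectivization
open MeasureTheory

namespace NodalMaps

noncomputable section

/-! ### The Riemann sphere and its automorphism group -/

/-- The complex projective line. -/
abbrev CP1 : Type := ℙ ℂ (Fin 2 → ℂ)

/-- The quotient topology on the complex projective line. -/
instance instTopologicalSpaceCP1 : TopologicalSpace CP1 :=
  TopologicalSpace.coinduced (fun v : {v : Fin 2 → ℂ // v ≠ 0} => Projectivization.mk ℂ v.1 v.2)
    inferInstance

/-- `PSL(2, ℂ)`, with the quotient topology of `SL(2, ℂ)`. It acts on `CP1` by Möbius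
transformations (the action is Mathlib's). -/
abbrev PSL2C : Type := Matrix.ProjectiveSpecialLinearGroup (Fin 2) ℂ

/-- The affine coordinate `z ↦ [z : 1]`, the embedding of `ℂ` into `CP1 = ℂ ∪ {∞}`. -/
def affine (z : ℂ) : CP1 := Projectivization.mk ℂ ![z, 1] (by simp)

/-- The point `∞ = [1 : 0]`. -/
def infty : CP1 := Projectivization.mk ℂ ![1, 0] (by simp)

/-- The three standard points `0, 1, ∞` of `CP1`. -/
def std : Fin 3 → CP1 := ![affine 0, affine 1, infty]

lemma continuous_smul_CP1 (g : PSL2C) : Continuous (fun x : CP1 => g • x) := by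
  obtain ⟨A, rfl⟩ := QuotientGroup.mk_surjective g
  refine continuous_coinduced_dom.2 ?_
  have hA : ∀ v : {v : Fin 2 → ℂ // v ≠ 0}, A.1.mulVec v.1 ≠ 0 := by
    intro v hv
    refine v.2 ?_
    have hdet : IsUnit A.1 := by
      rw [Matrix.isUnit_iff_isUnit_det]
      simp [A.2]
    exact (Matrix.mulVec_injective_iff_isUnit.2 hdet) (by simpa using hv)
  have h1 : Continuous (fun v : {v : Fin 2 → ℂ // v ≠ 0} =>
      (⟨A.1.mulVec v.1, hA v⟩ : {v : Fin 2 → ℂ // v ≠ 0})) :=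
    Continuous.subtype_mk (Continuous.matrix_mulVec continuous_const continuous_subtype_val) _
  exact continuous_coinduced_rng.comp h1

/-! ### Sobolev norms on planar domains -/

section Sobolev

variable {E : Type*} [NormedAddCommGroup E] [NormedSpace ℝ E]

/-- The partial derivative `∂_x^a ∂_y^b φ` of a function of `z = x + i y`. -/
def partialDeriv (a b : ℕ) (φ : ℂ → ℝ) (z : ℂ) : ℝ :=
  iteratedFDeriv ℝ (a + b) φ z (fun i => if (i : ℕ) < a then 1 else Complex.I)

/-- `w` is the weak partial derivative `∂_x^a ∂_y^b u` on the open set `Ω`. -/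
def HasWeakPartial (Ω : Set ℂ) (a b : ℕ) (u w : ℂ → E) : Prop :=
  LocallyIntegrableOn u Ω ∧ LocallyIntegrableOn w Ω ∧
    ∀ φ : ℂ → ℝ, ContDiff ℝ ∞ φ → HasCompactSupport φ → tsupport φ ⊆ Ω →
      ∫ z, partialDeriv a b φ z • u z = (-1 : ℝ) ^ (a + b) • ∫ z, φ z • w z

/-- The norm `∑_{a + b ≤ k} ‖∂_x^a ∂_y^b u‖_{L^p(Ω)}` of the Sobolev space `L_k^p(Ω)`. A weak
derivative is unique almost everywhere, so the infimum is over a single value if it exists; if one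
of the weak derivatives does not exist or is not in `L^p`, the norm is `∞`. -/
def sobolevNorm (k : ℕ) (p : ℝ) (Ω : Set ℂ) (u : ℂ → E) : ENNReal :=
  ∑ a ∈ Finset.range (k + 1), ∑ b ∈ Finset.range (k + 1 - a),
    ⨅ (w : ℂ → E) (_ : HasWeakPartial Ω a b u w),
      eLpNorm w (ENNReal.ofReal p) (volume.restrict Ω)

end Sobolev

/-! ### The space of `L_k^p`-maps from the sphere to a manifold -/

section Maps

variable {m : ℕ} {M : Type*} [TopologicalSpace M] [ChartedSpace (EuclideanSpace ℝ (Fin m)) M]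

/-- A coordinate disc in the domain together with a smooth chart of the target. The coordinates of
`CP1` are the affine coordinates `z ↦ g • [z : 1]`, `g ∈ PSL(2, ℂ)`, and the discs are round discs
of `ℂ` in these coordinates. -/
structure LocalData (m : ℕ) (M : Type*) [TopologicalSpace M]
    [ChartedSpace (EuclideanSpace ℝ (Fin m)) M] where
  coord : PSL2C
  center : ℂ
  radius : ℝ
  radius_pos : 0 < radius
  chart : OpenPartialHomeomorph M (EuclideanSpace ℝ (Fin m))
  chart_mem : chart ∈ IsManifold.maximalAtlas (𝓡 m) ∞ M

/-- `f` maps the closed coordinate disc into the domain of the target chart. -/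
def LocalData.Fits (D : LocalData m M) (f : CP1 → M) : Prop :=
  ∀ z ∈ Metric.closedBall D.center D.radius, f (D.coord • affine z) ∈ D.chart.source

/-- The coordinate expression of `f`. -/
def LocalData.rep (D : LocalData m M) (f : CP1 → M) (z : ℂ) : EuclideanSpace ℝ (Fin m) :=
  D.chart (f (D.coord • affine z))

/-- The open coordinate disc. -/
def LocalData.disc (D : LocalData m M) : Set ℂ := Metric.ball D.center D.radius

/-- Precomposing the coordinate of the domain with a Möbius transformation. -/
def LocalData.translate (D : LocalData m M) (g : PSL2C) : LocalData m M :=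
  { D with coord := g * D.coord }

/-- A map `CP1 → M` of class `L_k^p`: it is continuous and all its local coordinate expressions
are of class `L_k^p`. -/
structure LkpMap (m k : ℕ) (p : ℝ) (M : Type*) [TopologicalSpace M]
    [ChartedSpace (EuclideanSpace ℝ (Fin m)) M] where
  toFun : CP1 → M
  continuous_toFun : Continuous toFun
  sobolev : ∀ D : LocalData m M, D.Fits toFun → sobolevNorm k p D.disc (D.rep toFun) < ⊤

variable {k : ℕ} {p : ℝ}

/-- The set of maps `h` which map the closed disc of `D` into the chart of `D` and whose coordinate
expression there is `ε`-close to that of `f` in the `L_k^p`-norm. -/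
def LkpMap.nbhd (f : LkpMap m k p M) (D : LocalData m M) (ε : ENNReal) : Set (LkpMap m k p M) :=
  {h | D.Fits h.toFun ∧ sobolevNorm k p D.disc (fun z => D.rep h.toFun z - D.rep f.toFun z) < ε}

/-- The `L_k^p`-topology: convergence means `L_k^p`-convergence of coordinate expressions. -/
instance instTopologicalSpaceLkpMap : TopologicalSpace (LkpMap m k p M) :=
  TopologicalSpace.generateFrom
    {S | ∃ (f : LkpMap m k p M) (D : LocalData m M) (ε : ENNReal),
      D.Fits f.toFun ∧ 0 < ε ∧ S = f.nbhd D ε}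

/-- The composition `f ∘ g` of an `L_k^p`-map with a Möbius transformation. -/
def LkpMap.comp (f : LkpMap m k p M) (g : PSL2C) : LkpMap m k p M where
  toFun x := f.toFun (g • x)
  continuous_toFun := f.continuous_toFun.comp (continuous_smul_CP1 g)
  sobolev D hD := by
    have h1 : (D.translate g).Fits f.toFun := by
      intro z hz
      simpa [LocalData.translate, mul_smul] using hD z hz
    have h2 := f.sobolev _ h1
    have h3 : (D.translate g).rep f.toFun = D.rep (fun x => f.toFun (g • x)) := by
      funext z
      simp [LocalData.translate, LocalData.rep, mul_smul]
    rw [h3] at h2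
    exact h2

lemma LkpMap.comp_one (f : LkpMap m k p M) : f.comp 1 = f := by
  cases f; simp [LkpMap.comp]

lemma LkpMap.comp_mul (f : LkpMap m k p M) (g g' : PSL2C) :
    f.comp (g * g') = (f.comp g).comp g' := by
  cases f; simp [LkpMap.comp, mul_smul]

end Maps

/-! ### Labelled trees, stable curves, nodal maps -/

section Nodal

variable {V : Type*}

/-- The valence of a vertex of a (finite) tree. A vertex is unstable if its valence is `≤ 2`. -/
def valence (T : SimpleGraph V) (v : V) : ℕ := (T.neighborSet v).ncard

/-- A minimal stabilization of the tree `T`: a labelling of the vertices by `n` marked points such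
that valence plus number of labels is `3` at each unstable vertex, with no labels at stable
vertices (the subtraction is truncated). It comes with a choice of three among the special
points (double points and marked points) of each component, which are going to be put
at `0, 1, ∞`. -/
structure MinimalStabilization (T : SimpleGraph V) (n : ℕ) where
  label : Fin n → V
  minimal : ∀ v, Nat.card {i : Fin n // label i = v} = 3 - valence T v
  frame : ∀ v, Fin 3 ↪ (T.neighborSet v ⊕ {i : Fin n // label i = v})

variable {T : SimpleGraph V} {n : ℕ}

/-- The (names of the) special points of the component `v`: a double point `d_{vu}` for each
edge `[vu]`, and a marked point for each label on `v`. -/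
abbrev MinimalStabilization.SpecialPt (S : MinimalStabilization T n) (v : V) : Type _ :=
  T.neighborSet v ⊕ {i : Fin n // S.label i = v}

/-- A stable curve modelled on the labelled tree, i.e. a fibre of the universal curve: every
component is a copy of `CP1` with distinct special points, the first three of which are
at `0, 1, ∞`. The components `v, u` are joined at the double points `d_{vu}, d_{uv}`. -/
structure StableCurve (S : MinimalStabilization T n) where
  point : ∀ v, S.SpecialPt v → CP1
  injective : ∀ v, Function.Injective (point v)
  normalized : ∀ v i, point v (S.frame v i) = std i

/-- A parametrized nodal `L_k^p`-map modelled on the labelled tree: a stable curve as domain, and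
an `L_k^p`-map on each component such that the values at double points match. -/
structure NodalMap (S : MinimalStabilization T n) (m k : ℕ) (p : ℝ) (M : Type*)
    [TopologicalSpace M] [ChartedSpace (EuclideanSpace ℝ (Fin m)) M] where
  curve : StableCurve S
  map : V → LkpMap m k p M
  matching : ∀ v u (h : T.Adj v u),
    (map v).toFun (curve.point v (.inl ⟨u, h⟩)) = (map u).toFun (curve.point u (.inl ⟨v, h.symm⟩))

variable {S : MinimalStabilization T n} {m k : ℕ} {p : ℝ} {M : Type*} [TopologicalSpace M]
  [ChartedSpace (EuclideanSpace ℝ (Fin m)) M]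

/-- The topology as a subspace of the product of the positions of the special points and of the
spaces of `L_k^p`-maps of the components. -/
instance instTopologicalSpaceNodalMap : TopologicalSpace (NodalMap S m k p M) :=
  TopologicalSpace.induced
    (fun F => ((F.curve.point, F.map) : (∀ v, S.SpecialPt v → CP1) × (V → LkpMap m k p M)))
    inferInstance

/-- The group of automorphisms of the component `v` which fix its double points, for an unstable
vertex `v`. The special points of an unstable component are exactly the three which have
been put at `0, 1, ∞`. -/
def compGroup (S : MinimalStabilization T n) (v : V) : Subgroup PSL2C where
  carrier := {g | ∀ i : Fin 3, (S.frame v i).isLeft = true → g • std i = std i}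
  mul_mem' := by
    intro a b ha hb i hi
    rw [mul_smul, hb i hi, ha i hi]
  one_mem' := by
    intro i _
    exact one_smul _ _
  inv_mem' := by
    intro a ha i hi
    rw [inv_smul_eq_iff, ha i hi]

/-- The reparametrization group `G_T`: the product, over the unstable vertices, of the groups
`compGroup`, with the product topology. -/
abbrev GT (S : MinimalStabilization T n) : Type _ :=
  ∀ v : {v : V // valence T v ≤ 2}, compGroup S v.1

open Classical in
/-- An element of `G_T` as a family of automorphisms of all components, the identity on
stable ones. -/
def GT.onComp (g : GT S) (v : V) : PSL2C :=
  if h : valence T v ≤ 2 then (g ⟨v, h⟩ : PSL2C) else 1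

lemma GT.onComp_one (v : V) : GT.onComp (1 : GT S) v = 1 := by
  unfold GT.onComp; split_ifs <;> rfl

lemma GT.onComp_mul (g g' : GT S) (v : V) :
    GT.onComp (g * g') v = GT.onComp g v * GT.onComp g' v := by
  unfold GT.onComp; split_ifs
  · rfl
  · simp

lemma frame_surjective [Finite V] (S : MinimalStabilization T n) (v : V) (hv : valence T v ≤ 2) :
    Function.Surjective (S.frame v) := by
  have hcard : Nat.card (S.SpecialPt v) = 3 := by
    rw [Nat.card_sum, S.minimal v]
    have : Nat.card (T.neighborSet v) = valence T v := Nat.card_coe_set_eq _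
    omega
  exact ((Nat.bijective_iff_injective_and_card _).2
    ⟨(S.frame v).injective, by simp [hcard]⟩).2

lemma onComp_smul_double [Finite V] (C : StableCurve S) (g : GT S) (v : V) (d : T.neighborSet v) :
    GT.onComp g v • C.point v (.inl d) = C.point v (.inl d) := by
  unfold GT.onComp
  split_ifs with hv
  · obtain ⟨i, hi⟩ := frame_surjective S v hv (.inl d)
    rw [← hi, C.normalized v i]
    exact (g ⟨v, hv⟩).2 i (by simp [hi])
  · exact one_smul _ _

/-- The action of `g ∈ G_T` on a nodal map by reparametrization: the domain is unchanged, and the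
components are composed with those of `g`. -/
def NodalMap.reparam [Finite V] (F : NodalMap S m k p M) (g : GT S) : NodalMap S m k p M where
  curve := F.curve
  map v := (F.map v).comp (GT.onComp g v)
  matching v u h := by
    simp only [LkpMap.comp, onComp_smul_double]
    exact F.matching v u h

/-- A nodal map is weakly stable if none of its unstable components is a constant map. -/
def NodalMap.WeaklyStable (F : NodalMap S m k p M) : Prop :=
  ∀ v, valence T v ≤ 2 → ¬ ∃ c : M, ∀ x, (F.map v).toFun x = c

lemma NodalMap.WeaklyStable.reparam [Finite V] {F : NodalMap S m k p M} (hF : F.WeaklyStable)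
    (g : GT S) : (F.reparam g).WeaklyStable := by
  rintro v hv ⟨c, hc⟩
  refine hF v hv ⟨c, fun x => ?_⟩
  have := hc ((GT.onComp g v)⁻¹ • x)
  simpa [NodalMap.reparam, LkpMap.comp] using this

/-- The space of weakly stable nodal `L_k^p`-maps, with the subspace topology. -/
abbrev WSNodalMap (S : MinimalStabilization T n) (m k : ℕ) (p : ℝ) (M : Type*)
    [TopologicalSpace M] [ChartedSpace (EuclideanSpace ℝ (Fin m)) M] : Type _ :=
  {F : NodalMap S m k p M // F.WeaklyStable}

/-- The action of `G_T` on weakly stable nodal maps by reparametrization, `g · f = f ∘ g`. -/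
def WSNodalMap.reparam [Finite V] (g : GT S) (f : WSNodalMap S m k p M) : WSNodalMap S m k p M :=
  ⟨f.1.reparam g, f.2.reparam g⟩

lemma WSNodalMap.reparam_one [Finite V] (f : WSNodalMap S m k p M) :
    WSNodalMap.reparam 1 f = f := by
  apply Subtype.ext
  obtain ⟨⟨C, F, hF⟩, hw⟩ := f
  simp [WSNodalMap.reparam, NodalMap.reparam, GT.onComp_one, LkpMap.comp_one]

lemma WSNodalMap.reparam_mul [Finite V] (g g' : GT S) (f : WSNodalMap S m k p M) :
    WSNodalMap.reparam (g * g') f = WSNodalMap.reparam g' (WSNodalMap.reparam g f) := by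
  apply Subtype.ext
  obtain ⟨⟨C, F, hF⟩, hw⟩ := f
  simp [WSNodalMap.reparam, NodalMap.reparam, GT.onComp_mul, LkpMap.comp_mul]

end Nodal

end

end NodalMaps

open NodalMaps

open scoped Manifold ContDiff LinearAlgebra.Projectivization Matrix.Norms.Elementwise
open MeasureTheory Filter Topology

namespace NodalMaps

/-! ### Topology of the projective line and divergence in `PSL(2, ℂ)` -/

/-! The substance is convergence dynamics on one component. If Möbius maps `g` leave every compact
subset of `PSL2C`, their matrices, scaled to norm one, accumulate at a matrix of determinant zero.
It has rank one, so in the limit `g • z → x` for every `z` except one point `y`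
(`exists_tendsto_smul_of_le_cocompact`). If moreover `h → f₁` and `h ∘ g → f₂`, joint continuity of
evaluation (`LkpMap.tendsto_eval`) gives `f₂ z = f₁ x` for all `z ≠ y`. The complement of `y` is
dense, so `f₂` is constant, which weak stability excludes on unstable components.

For nodal maps this is applied at every unstable vertex. An element outside a product of compact
sets escapes in at least one factor, and that factor alone separates the neighbourhoods. -/

lemma mk_eq_mk_iff_cross {u v : Fin 2 → ℂ} (hu : u ≠ 0) (hv : v ≠ 0) :
    Projectivization.mk ℂ u hu = Projectivization.mk ℂ v hv ↔ u 0 * v 1 = u 1 * v 0 := by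
  rw [Projectivization.mk_eq_mk_iff']
  constructor
  · rintro ⟨a, rfl⟩
    simp only [Pi.smul_apply, smul_eq_mul]
    ring
  · intro h
    by_cases h0 : v 0 = 0
    · have h1 : v 1 ≠ 0 := by
        intro h1
        exact hv (by ext i; fin_cases i <;> simp [h0, h1])
      have hu0 : u 0 = 0 := by simpa [h0, h1] using h
      refine ⟨u 1 / v 1, ?_⟩
      ext i; fin_cases i
      · simp [h0, hu0]
      · simp [h1]
    · refine ⟨u 0 / v 0, ?_⟩
      ext i; fin_cases i
      · simp [h0]
      · simp only [Pi.smul_apply, smul_eq_mul, Fin.mk_one]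
        field_simp
        linear_combination h

lemma continuous_mk : Continuous
    (fun v : {v : Fin 2 → ℂ // v ≠ 0} => (Projectivization.mk ℂ v.1 v.2 : CP1)) :=
  continuous_coinduced_rng

lemma continuous_coord (i : Fin 2) :
    Continuous (fun v : {v : Fin 2 → ℂ // v ≠ 0} => v.1 i) :=
  (continuous_apply i).comp continuous_subtype_val

lemma tendsto_mk {ι : Type*} {l : Filter ι} {u : ι → Fin 2 → ℂ} (hu : ∀ i, u i ≠ 0)
    {v : Fin 2 → ℂ} (hv : v ≠ 0) (h : Tendsto u l (𝓝 v)) :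
    Tendsto (fun i => (Projectivization.mk ℂ (u i) (hu i) : CP1)) l
      (𝓝 (Projectivization.mk ℂ v hv)) :=
  (continuous_mk.tendsto ⟨v, hv⟩).comp
    (tendsto_subtype_rng.2 h : Tendsto (fun i => (⟨u i, hu i⟩ : {v : Fin 2 → ℂ // v ≠ 0})) l _)

instance : T1Space CP1 where
  t1 x := by
    induction x using Projectivization.ind with
    | h w hw =>
      have hset : (fun v : {v : Fin 2 → ℂ // v ≠ 0} => Projectivization.mk ℂ v.1 v.2) ⁻¹'
          {Projectivization.mk ℂ w hw} = {v | v.1 0 * w 1 = v.1 1 * w 0} := by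
        ext v
        exact mk_eq_mk_iff_cross v.2 hw
      refine isClosed_coinduced.2 ?_
      rw [hset]
      exact isClosed_eq ((continuous_coord 0).mul continuous_const)
        ((continuous_coord 1).mul continuous_const)

lemma affine_eq_mk_iff {z : ℂ} {v : Fin 2 → ℂ} (hv : v ≠ 0) :
    affine z = Projectivization.mk ℂ v hv ↔ z * v 1 = v 0 := by
  rw [affine, mk_eq_mk_iff_cross]
  simp

/-- Upstairs the image is cut out by a homogeneous strict inequality. This supplies the disc
neighbourhoods of a point used in `LkpMap.tendsto_eval`. -/
lemma isOpen_affine_image_ball (r : ℝ) : IsOpen (affine '' Metric.ball 0 r) := by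
  have hset : (fun v : {v : Fin 2 → ℂ // v ≠ 0} => (Projectivization.mk ℂ v.1 v.2 : CP1)) ⁻¹'
      (affine '' Metric.ball 0 r) = {v | ‖v.1 0‖ < r * ‖v.1 1‖} := by
    ext ⟨v, hv⟩
    simp only [Set.mem_preimage, Set.mem_image, mem_ball_zero_iff, affine_eq_mk_iff,
      Set.mem_ofPred_eq]
    have hv1 : v 1 = 0 → v 0 ≠ 0 := fun h1 h0 =>
      hv (by ext i; fin_cases i <;> simp [h0, h1])
    constructor
    · rintro ⟨z, hz, h⟩
      have h1 : v 1 ≠ 0 := fun h1 => hv1 h1 (by simp [← h, h1])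
      rw [← h, norm_mul]
      exact mul_lt_mul_of_pos_right hz (norm_pos_iff.2 h1)
    · intro h
      have h1 : v 1 ≠ 0 := by
        intro h1
        rw [h1, norm_zero, mul_zero] at h
        exact absurd h (norm_nonneg _).not_gt
      refine ⟨v 0 / v 1, ?_, div_mul_cancel₀ _ h1⟩
      rwa [norm_div, div_lt_iff₀ (norm_pos_iff.2 h1)]
  refine isOpen_coinduced.2 ?_
  rw [hset]
  exact isOpen_lt (continuous_coord 0).norm (continuous_const.mul (continuous_coord 1).norm)

lemma continuous_affine : Continuous affine := by
  refine continuous_mk.comp (g := fun v : {v : Fin 2 → ℂ // v ≠ 0} => _)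
    (f := fun z : ℂ => ⟨![z, 1], by simp⟩) ?_
  refine Continuous.subtype_mk (continuous_pi fun i => ?_) _
  fin_cases i
  · exact continuous_id
  · exact continuous_const

lemma dense_compl_singleton_CP1 (y : CP1) : Dense ({y}ᶜ : Set CP1) := by
  rw [dense_compl_singleton_iff_not_open]
  intro hy
  obtain ⟨g, rfl⟩ := MulAction.exists_smul_eq PSL2C (affine 0) y
  have h1 : IsOpen ((fun z : ℂ => g • affine z) ⁻¹' {g • affine 0}) :=
    hy.preimage ((continuous_smul_CP1 g).comp continuous_affine)
  have h2 : (fun z : ℂ => g • affine z) ⁻¹' {g • affine 0} = {0} := by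
    ext z
    simp only [Set.mem_preimage, Set.mem_singleton_iff, smul_left_cancel_iff]
    rw [affine, affine, mk_eq_mk_iff_cross]
    simp
  rw [h2] at h1
  exact not_isOpen_singleton (0 : ℂ) h1

/-! ### Continuity of the action and escape to infinity -/

lemma smul_mk_eq (A : Matrix.SpecialLinearGroup (Fin 2) ℂ) {v : Fin 2 → ℂ} (hv : v ≠ 0)
    {w : Fin 2 → ℂ} (hw : w ≠ 0) {c : ℂ} (hc : c ≠ 0) (h : w = c • A.1.mulVec v) :
    (QuotientGroup.mk A : PSL2C) • (Projectivization.mk ℂ v hv : CP1) =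
      Projectivization.mk ℂ w hw := by
  change Projectivization.mk ℂ (A.1.mulVec v) _ = _
  exact (Projectivization.mk_eq_mk_iff' ..).2
    ⟨c⁻¹, by rw [h, smul_smul, inv_mul_cancel₀ hc, one_smul]⟩

lemma continuous_smul_const_CP1 (x : CP1) : Continuous (fun g : PSL2C => g • x) := by
  induction x using Projectivization.ind with
  | h w hw =>
    refine continuous_coinduced_dom.2 ?_
    have hne : ∀ A : Matrix.SpecialLinearGroup (Fin 2) ℂ, A.1.mulVec w ≠ 0 := by
      intro A h
      exact hw (Matrix.eq_zero_of_mulVec_eq_zero (by simp [A.2]) h)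
    have hcont : Continuous (fun A : Matrix.SpecialLinearGroup (Fin 2) ℂ =>
        (⟨A.1.mulVec w, hne A⟩ : {v : Fin 2 → ℂ // v ≠ 0})) :=
      Continuous.subtype_mk
        (Continuous.matrix_mulVec continuous_subtype_val continuous_const) _
    exact continuous_mk.comp hcont

/-- `det = 1` is a closed condition in a finite-dimensional space. Hence escaping to infinity in the
group forces the matrix norm to infinity. -/
lemma isCompact_setOf_norm_le_SL2 (R : ℝ) :
    IsCompact {A : Matrix.SpecialLinearGroup (Fin 2) ℂ | ‖A.1‖ ≤ R} := by
  have hcl : IsClosed {A : Matrix (Fin 2) (Fin 2) ℂ | A.det = 1} :=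
    isClosed_eq (Continuous.matrix_det continuous_id) continuous_const
  have hemb : IsClosedEmbedding
      (Subtype.val : Matrix.SpecialLinearGroup (Fin 2) ℂ → Matrix (Fin 2) (Fin 2) ℂ) :=
    hcl.isClosedEmbedding_subtypeVal
  have h := hemb.isCompact_preimage (isCompact_closedBall (0 : Matrix (Fin 2) (Fin 2) ℂ) R)
  have hset : {A : Matrix.SpecialLinearGroup (Fin 2) ℂ | ‖A.1‖ ≤ R} =
      Subtype.val ⁻¹' Metric.closedBall (0 : Matrix (Fin 2) (Fin 2) ℂ) R := by
    ext A
    exact mem_closedBall_zero_iff.symm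
  rw [hset]
  exact h

/-- If a `2 × 2`-matrix has rank one, it maps the complement of its kernel to one line. -/
lemma exists_smul_mulVec_of_det_eq_zero {B : Matrix (Fin 2) (Fin 2) ℂ} (hB : B ≠ 0)
    (hdet : B.det = 0) :
    ∃ x y : Fin 2 → ℂ, x ≠ 0 ∧ y ≠ 0 ∧
      ∀ v : Fin 2 → ℂ, v 0 * y 1 ≠ v 1 * y 0 → ∃ c : ℂ, c ≠ 0 ∧ B.mulVec v = c • x := by
  obtain ⟨y, hy, hBy⟩ := Matrix.exists_mulVec_eq_zero_iff.2 hdet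
  obtain ⟨w, hw⟩ : ∃ w, B.mulVec w ≠ 0 := by
    by_contra! h
    exact hB (Matrix.mulVec_injective (by ext1 w; rw [h w, Matrix.zero_mulVec]))
  -- In dimension two any three vectors satisfy a Plücker relation. Applying `B` to it kills the
  -- term in the kernel vector `y`.
  have key : ∀ v : Fin 2 → ℂ, (y 0 * w 1 - y 1 * w 0) • B.mulVec v =
      (y 0 * v 1 - y 1 * v 0) • B.mulVec w := by
    intro v
    have hdecomp : (y 0 * w 1 - y 1 * w 0) • v =
        (v 0 * w 1 - v 1 * w 0) • y + (y 0 * v 1 - y 1 * v 0) • w := by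
      ext i; fin_cases i <;> simp <;> ring
    rw [← Matrix.mulVec_smul, hdecomp, Matrix.mulVec_add, Matrix.mulVec_smul, Matrix.mulVec_smul,
      hBy, smul_zero, zero_add]
  have hd : y 0 * w 1 - y 1 * w 0 ≠ 0 := by
    intro h
    have hcoeff : ∀ v : Fin 2 → ℂ, y 0 * v 1 - y 1 * v 0 = 0 := fun v => by
      have := key v
      rw [h, zero_smul, eq_comm, smul_eq_zero] at this
      exact this.resolve_right hw
    have h0 : y 0 = 0 := by simpa using hcoeff ![0, 1]
    have h1 : y 1 = 0 := by simpa using hcoeff ![1, 0]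
    exact hy (by ext i; fin_cases i <;> simp [h0, h1])
  refine ⟨B.mulVec w, y, hw, hy, fun v hv => ⟨(y 0 * w 1 - y 1 * w 0)⁻¹ *
    (y 0 * v 1 - y 1 * v 0), mul_ne_zero (inv_ne_zero hd) ?_, ?_⟩⟩
  · intro h
    exact hv (by linear_combination -h)
  · rw [mul_smul, ← key v, smul_smul, inv_mul_cancel₀ hd, one_smul]

/-- Möbius transformations diverging along an ultrafilter converge pointwise to a constant, away
from one point. -/
lemma exists_tendsto_smul_of_le_cocompact (L : Ultrafilter PSL2C)
    (hL : (L : Filter PSL2C) ≤ cocompact PSL2C) :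
    ∃ x y : CP1, ∀ z, z ≠ y → Tendsto (fun g : PSL2C => g • z) L (𝓝 x) := by
  -- An arbitrary choice of lifts suffices: only their norms and normalized limits matter, so no
  -- continuity is needed.
  let s : PSL2C → Matrix.SpecialLinearGroup (Fin 2) ℂ := fun g => g.out
  have hs : ∀ g, (QuotientGroup.mk (s g) : PSL2C) = g := fun g => QuotientGroup.out_eq' g
  have hN : Tendsto (fun g => ‖(s g).1‖) L atTop := by
    refine tendsto_atTop.2 fun R => hL ?_
    have hc : IsCompact ((fun A => (QuotientGroup.mk A : PSL2C)) ''
        {A : Matrix.SpecialLinearGroup (Fin 2) ℂ | ‖A.1‖ ≤ R}) :=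
      (isCompact_setOf_norm_le_SL2 R).image continuous_quot_mk
    filter_upwards [hc.compl_mem_cocompact] with g hg
    by_contra! h
    exact hg ⟨s g, h.le, hs g⟩
  have hpos : ∀ g, 0 < ‖(s g).1‖ := by
    intro g
    refine norm_pos_iff.2 fun h => ?_
    have := (s g).2
    rw [h] at this
    simp at this
  let c : PSL2C → ℂ := fun g => ((‖(s g).1‖⁻¹ : ℝ) : ℂ)
  have hc0 : ∀ g, c g ≠ 0 := fun g => by simpa [c] using (hpos g).ne'
  have hcnorm : ∀ g, ‖c g‖ = ‖(s g).1‖⁻¹ := fun g => by simp [c]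
  have hclim : Tendsto c L (𝓝 0) := by
    rw [tendsto_zero_iff_norm_tendsto_zero]
    simp only [hcnorm]
    exact tendsto_inv_atTop_zero.comp hN
  -- Rescaling leaves the projective action unchanged and puts the matrices on the compact unit
  -- sphere, where the ultrafilter has a limit.
  let B : PSL2C → Matrix (Fin 2) (Fin 2) ℂ := fun g => c g • (s g).1
  have hBnorm : ∀ g, ‖B g‖ = 1 := fun g => by
    rw [norm_smul, hcnorm, inv_mul_cancel₀ (hpos g).ne']
  obtain ⟨B₀, hB₀, hlim⟩ := (isCompact_sphere (0 : Matrix (Fin 2) (Fin 2) ℂ) 1).ultrafilter_le_nhds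
    (L.map B) (by
      rw [le_principal_iff]
      refine Ultrafilter.mem_map.2 (Eventually.of_forall fun g => ?_)
      simp [hBnorm g])
  have hlim : Tendsto B L (𝓝 B₀) := hlim
  have hB₀ne : B₀ ≠ 0 := by
    rintro rfl
    simp at hB₀
  have hdet : B₀.det = 0 := by
    have h1 : Tendsto (fun g => (B g).det) L (𝓝 B₀.det) :=
      ((Continuous.matrix_det continuous_id).tendsto B₀).comp hlim
    have h2 : ∀ g, (B g).det = c g ^ 2 := fun g => by
      simp [B, (s g).2]
    -- The scaled determinant is the square of a factor tending to zero, so the limit is singular.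
    simp only [h2] at h1
    refine tendsto_nhds_unique h1 ?_
    simpa using hclim.pow 2
  obtain ⟨x, y, hx, hy, hxy⟩ := exists_smul_mulVec_of_det_eq_zero hB₀ne hdet
  refine ⟨Projectivization.mk ℂ x hx, Projectivization.mk ℂ y hy, fun z hz => ?_⟩
  induction z using Projectivization.ind with
  | h v hv =>
    obtain ⟨a, ha, hBv⟩ := hxy v (fun h => hz ((mk_eq_mk_iff_cross hv hy).2 h))
    have hBgv : ∀ g, (B g).mulVec v = c g • (s g).1.mulVec v := fun g =>
      Matrix.smul_mulVec ..
    have hne : ∀ g, (B g).mulVec v ≠ 0 := by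
      intro g h
      rw [hBgv, smul_eq_zero, or_iff_right (hc0 g)] at h
      exact hv (Matrix.eq_zero_of_mulVec_eq_zero (by simp [(s g).2]) h)
    have hmk : Projectivization.mk ℂ x hx =
        Projectivization.mk ℂ (B₀.mulVec v) (by rw [hBv]; exact smul_ne_zero ha hx) := by
      rw [Eq.comm, Projectivization.mk_eq_mk_iff']
      exact ⟨a, hBv.symm⟩
    rw [hmk]
    have hg : (fun g : PSL2C => g • (Projectivization.mk ℂ v hv : CP1)) =
        fun g => Projectivization.mk ℂ ((B g).mulVec v) (hne g) := by
      funext g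
      conv_lhs => rw [← hs g]
      exact smul_mk_eq (s g) hv (hne g) (hc0 g) (hBgv g)
    rw [hg]
    exact tendsto_mk hne _
      (((Continuous.matrix_mulVec continuous_id continuous_const).tendsto B₀).comp hlim)

/-! ### Evaluation of maps of class `L_k^p` -/

section Maps

variable {m : ℕ} {M : Type*} [TopologicalSpace M] [ChartedSpace (EuclideanSpace ℝ (Fin m)) M]
  {k : ℕ} {p : ℝ}

lemma hasWeakPartial_zero {E : Type*} [NormedAddCommGroup E] [NormedSpace ℝ E] (Ω : Set ℂ)
    (a b : ℕ) : HasWeakPartial Ω a b (fun _ => (0 : E)) (fun _ => (0 : E)) :=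
  ⟨locallyIntegrable_zero.locallyIntegrableOn _, locallyIntegrable_zero.locallyIntegrableOn _,
    fun φ _ _ _ => by simp⟩

lemma sobolevNorm_zero {E : Type*} [NormedAddCommGroup E] [NormedSpace ℝ E] (k : ℕ) (p : ℝ)
    (Ω : Set ℂ) : sobolevNorm k p Ω (fun _ => (0 : E)) = 0 := by
  refine Finset.sum_eq_zero fun a _ => Finset.sum_eq_zero fun b _ => ?_
  refine le_antisymm (iInf₂_le_of_le _ (hasWeakPartial_zero Ω a b) ?_) zero_le
  simp

/-- The radius `1` is arbitrary, since only the condition `Fits` is kept. Through it the topology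
controls values uniformly on discs, which is all the argument takes from the Sobolev structure. -/
lemma LkpMap.mem_nbhds_setOf_fits (f : LkpMap m k p M) (D : LocalData m M)
    (hD : D.Fits f.toFun) : {h : LkpMap m k p M | D.Fits h.toFun} ∈ 𝓝 f := by
  have hopen : IsOpen (f.nbhd D 1) :=
    TopologicalSpace.isOpen_generateFrom_of_mem ⟨f, D, 1, hD, one_pos, rfl⟩
  refine mem_of_superset (hopen.mem_nhds ⟨hD, ?_⟩) fun h hh => hh.1
  simp only [sub_self, sobolevNorm_zero]
  exact one_pos

/-- Around every point of the domain there is a coordinate disc which `f` maps into a chart domain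
contained in a given neighbourhood. -/
lemma exists_localData [IsManifold (𝓡 m) ∞ M] {f : CP1 → M} (hf : Continuous f) (x : CP1)
    {W : Set M} (hW : IsOpen W) (hx : f x ∈ W) :
    ∃ D : LocalData m M, D.center = 0 ∧ D.coord • affine 0 = x ∧ D.chart.source ⊆ W ∧
      D.Fits f := by
  obtain ⟨g, rfl⟩ := MulAction.exists_smul_eq PSL2C (affine 0) x
  -- Restricting the chart to `W` turns `Fits` into the statement that the whole closed disc is
  -- mapped into `W`.
  let e := (chartAt (EuclideanSpace ℝ (Fin m)) (f (g • affine 0))).restr W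
  have hsrc : e.source =
      (chartAt (EuclideanSpace ℝ (Fin m)) (f (g • affine 0))).source ∩ W :=
    OpenPartialHomeomorph.restr_source' _ _ hW
  have he : e ∈ IsManifold.maximalAtlas (𝓡 m) ∞ M :=
    restr_mem_maximalAtlas _ (IsManifold.chart_mem_maximalAtlas _) hW
  have hcont : Continuous (fun z : ℂ => f (g • affine z)) :=
    hf.comp ((continuous_smul_CP1 g).comp continuous_affine)
  have hmem : (fun z : ℂ => f (g • affine z)) ⁻¹' e.source ∈ 𝓝 (0 : ℂ) := by
    refine hcont.continuousAt.preimage_mem_nhds (e.open_source.mem_nhds ?_)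
    rw [hsrc]
    exact ⟨mem_chart_source _ _, hx⟩
  obtain ⟨r, hr, hball⟩ := Metric.nhds_basis_closedBall.mem_iff.1 hmem
  exact ⟨⟨g, 0, r, hr, e, he⟩, rfl, rfl, hsrc ▸ Set.inter_subset_right, fun z hz => hball hz⟩

/-- Evaluation of maps of class `L_k^p` is jointly continuous. -/
lemma LkpMap.tendsto_eval [IsManifold (𝓡 m) ∞ M] {ι : Type*} {l : Filter ι}
    {h : ι → LkpMap m k p M} {f : LkpMap m k p M} {z : ι → CP1} {x : CP1}
    (hh : Tendsto h l (𝓝 f)) (hz : Tendsto z l (𝓝 x)) :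
    Tendsto (fun i => (h i).toFun (z i)) l (𝓝 (f.toFun x)) := by
  refine tendsto_nhds.2 fun W hW hx => ?_
  obtain ⟨D, hc, rfl, hDW, hfit⟩ := exists_localData (m := m) f.continuous_toFun x hW hx
  have hnhds : (fun y => D.coord⁻¹ • y) ⁻¹' (affine '' Metric.ball 0 D.radius) ∈
      𝓝 (D.coord • affine 0) := by
    refine ((isOpen_affine_image_ball D.radius).preimage
      (continuous_smul_CP1 D.coord⁻¹)).mem_nhds ?_
    simpa using ⟨0, by simpa using D.radius_pos, rfl⟩
  filter_upwards [hh (f.mem_nbhds_setOf_fits D hfit), hz hnhds] with i hi hzi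
  obtain ⟨w, hw, hwz⟩ := hzi
  have : z i = D.coord • affine w := by rw [hwz, smul_inv_smul]
  rw [Set.mem_preimage, this]
  exact hDW (hi w (hc ▸ Metric.ball_subset_closedBall hw))

/-- Properness of the reparametrization action on maps `CP1 → M`, near a pair of maps of which
the second one is not constant. -/
lemma LkpMap.exists_nbhds_comp_notMem [T2Space M] [IsManifold (𝓡 m) ∞ M]
    (f₁ f₂ : LkpMap m k p M) (hf₂ : ¬ ∃ c : M, ∀ x, f₂.toFun x = c) :
    ∃ (U₁ U₂ : Set (LkpMap m k p M)) (K : Set PSL2C), IsOpen U₁ ∧ f₁ ∈ U₁ ∧ IsOpen U₂ ∧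
      f₂ ∈ U₂ ∧ IsCompact K ∧ ∀ h ∈ U₁, ∀ g ∉ K, h.comp g ∉ U₂ := by
  by_contra! hcon
  -- Failure for all neighbourhoods and compact sets makes this filter nontrivial. An ultrafilter
  -- below it plays the role of a subsequence, without countability assumptions.
  let F : Filter (LkpMap m k p M × PSL2C) :=
    (𝓝 f₁ ×ˢ cocompact PSL2C) ⊓ comap (fun q => q.1.comp q.2) (𝓝 f₂)
  have hF : F.NeBot := by
    refine inf_neBot_iff.2 fun s hs t ht => ?_
    obtain ⟨A, hA, C, hC, hAC⟩ := mem_prod_iff.1 hs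
    obtain ⟨U₁, hU₁A, hU₁, hf₁⟩ := mem_nhds_iff.1 hA
    obtain ⟨K, hK, hKC⟩ := mem_cocompact.1 hC
    obtain ⟨A', hA', hAt⟩ := ht
    obtain ⟨U₂, hU₂A', hU₂, hf₂⟩ := mem_nhds_iff.1 hA'
    obtain ⟨h, hh, g, hg, hgh⟩ := hcon U₁ U₂ K hU₁ hf₁ hU₂ hf₂ hK
    exact ⟨(h, g), hAC ⟨hU₁A hh, hKC hg⟩, hAt (hU₂A' hgh)⟩
  let u : Ultrafilter (LkpMap m k p M × PSL2C) := Ultrafilter.of F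
  have hu : (u : Filter _) ≤ F := Ultrafilter.of_le F
  have hu₁ : Tendsto Prod.fst (u : Filter (LkpMap m k p M × PSL2C)) (𝓝 f₁) :=
    tendsto_fst.mono_left (hu.trans inf_le_left)
  have hug : Tendsto Prod.snd (u : Filter (LkpMap m k p M × PSL2C)) (cocompact PSL2C) :=
    tendsto_snd.mono_left (hu.trans inf_le_left)
  have hu₂ : Tendsto (fun q : LkpMap m k p M × PSL2C => q.1.comp q.2) u (𝓝 f₂) :=
    tendsto_comap.mono_left (hu.trans inf_le_right)
  obtain ⟨x, y, hxy⟩ := exists_tendsto_smul_of_le_cocompact (u.map Prod.snd) hug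
  have heq : Set.EqOn f₂.toFun (fun _ => f₁.toFun x) {y}ᶜ := by
    -- The same values `h (g • z)` are read in two ways: as `h ∘ g` at the fixed point `z`, and as
    -- `h` at the moving point `g • z → x`.
    intro z hz
    have hz₂ : Tendsto (fun q : LkpMap m k p M × PSL2C => q.1.toFun (q.2 • z)) u
        (𝓝 (f₂.toFun z)) :=
      LkpMap.tendsto_eval (h := fun q : LkpMap m k p M × PSL2C => q.1.comp q.2) hu₂
        (tendsto_const_nhds (x := z))
    have hz₁ : Tendsto (fun q : LkpMap m k p M × PSL2C => q.1.toFun (q.2 • z)) u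
        (𝓝 (f₁.toFun x)) := LkpMap.tendsto_eval hu₁ ((hxy z hz).comp tendsto_map)
    exact tendsto_nhds_unique hz₂ hz₁
  exact hf₂ ⟨f₁.toFun x, congrFun (f₂.continuous_toFun.ext_on (dense_compl_singleton_CP1 y)
    continuous_const heq)⟩

end Maps

/-! ### Nodal maps -/

section Nodal

variable {V : Type*} {T : SimpleGraph V} {n : ℕ} {S : MinimalStabilization T n}
  {m k : ℕ} {p : ℝ} {M : Type*} [TopologicalSpace M] [ChartedSpace (EuclideanSpace ℝ (Fin m)) M]

/-- Closedness makes the trace on the subgroup of a compact set in `PSL2C` compact again. It needs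
only that points of `CP1` are closed. -/
lemma isClosed_compGroup (S : MinimalStabilization T n) (v : V) :
    IsClosed (compGroup S v : Set PSL2C) := by
  have : (compGroup S v : Set PSL2C) =
      ⋂ (i : Fin 3) (_ : (S.frame v i).isLeft = true), {g | g • std i = std i} := by
    ext g
    simp [compGroup]
  rw [this]
  exact isClosed_iInter fun i => isClosed_iInter fun _ =>
    isClosed_singleton.preimage (continuous_smul_const_CP1 (std i))

lemma WSNodalMap.continuous_map (v : V) :
    Continuous (fun F : WSNodalMap S m k p M => F.1.map v) :=
  (continuous_apply v).comp (continuous_snd.comp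
    ((continuous_induced_dom (f := fun F : NodalMap S m k p M =>
      ((F.curve.point, F.map) : (∀ v, S.SpecialPt v → CP1) × (V → LkpMap m k p M)))).comp
        continuous_subtype_val))

lemma WSNodalMap.exists_nbhds_reparam_notMem [Finite V] [T2Space M] [IsManifold (𝓡 m) ∞ M]
    (f₁ f₂ : WSNodalMap S m k p M) :
    ∃ (U₁ U₂ : Set (WSNodalMap S m k p M)) (K : Set (GT S)), IsOpen U₁ ∧ f₁ ∈ U₁ ∧
      IsOpen U₂ ∧ f₂ ∈ U₂ ∧ IsCompact K ∧ ∀ h ∈ U₁, ∀ g ∉ K, WSNodalMap.reparam g h ∉ U₂ := by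
  choose U₁ U₂ K hU₁ hf₁ hU₂ hf₂ hK hcomp using
    fun v : {v : V // valence T v ≤ 2} =>
      LkpMap.exists_nbhds_comp_notMem (f₁.1.map v.1) (f₂.1.map v.1) (f₂.2 v.1 v.2)
  refine ⟨⋂ v : {v : V // valence T v ≤ 2}, (fun F : WSNodalMap S m k p M => F.1.map v.1) ⁻¹' U₁ v,
    ⋂ v : {v : V // valence T v ≤ 2}, (fun F : WSNodalMap S m k p M => F.1.map v.1) ⁻¹' U₂ v,
    Set.univ.pi fun v => Subtype.val ⁻¹' K v,
    isOpen_iInter_of_finite fun v => (hU₁ v).preimage (WSNodalMap.continuous_map v.1),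
    Set.mem_iInter.2 fun v => hf₁ v,
    isOpen_iInter_of_finite fun v => (hU₂ v).preimage (WSNodalMap.continuous_map v.1),
    Set.mem_iInter.2 fun v => hf₂ v,
    isCompact_univ_pi fun v =>
      (isClosed_compGroup S v.1).isClosedEmbedding_subtypeVal.isCompact_preimage (hK v), ?_⟩
  intro h hh g hg hgh
  -- Lying outside the product box means lying outside `K v` for some single `v`.
  simp only [Set.mem_pi, Set.mem_univ, Set.mem_preimage, true_imp_iff, not_forall] at hg
  obtain ⟨v, hv⟩ := hg
  refine hcomp v (h.1.map v.1) (Set.mem_iInter.1 hh v) (g v) hv ?_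
  have hmem := Set.mem_iInter.1 hgh v
  simpa [WSNodalMap.reparam, NodalMap.reparam, GT.onComp, v.2] using hmem

end Nodal

end NodalMaps

open NodalMaps
theorem theorem1p3 {V : Type*} [Finite V] (T : SimpleGraph V) (hT : T.IsTree) {n : ℕ}
    (S : MinimalStabilization T n)
    {m : ℕ} {M : Type*} [TopologicalSpace M] [T2Space M]
    [ChartedSpace (EuclideanSpace ℝ (Fin m)) M] [IsManifold (𝓡 m) ∞ M]
    (k : ℕ) (p : ℝ) (hp : 1 ≤ p) (hkp : 1 ≤ (k : ℝ) - 2 / p)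
    (f₁ f₂ : WSNodalMap S m k p M) :
    ∃ (U₁ U₂ : Set (WSNodalMap S m k p M)) (K₁ K₂ : Set (GT S)),
      IsOpen U₁ ∧ f₁ ∈ U₁ ∧ IsOpen U₂ ∧ f₂ ∈ U₂ ∧ IsCompact K₁ ∧ IsCompact K₂ ∧
      (∀ h₁ ∈ U₁, ∀ g₁ ∉ K₁, WSNodalMap.reparam g₁ h₁ ∉ U₂) ∧
      (∀ h₂ ∈ U₂, ∀ g₂ ∉ K₂, WSNodalMap.reparam g₂ h₂ ∉ U₁) := by
  obtain ⟨U₁, U₂, K₁, hU₁, hf₁, hU₂, hf₂, hK₁, h₁⟩ :=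
    WSNodalMap.exists_nbhds_reparam_notMem f₁ f₂
  obtain ⟨U₂', U₁', K₂, hU₂', hf₂', hU₁', hf₁', hK₂, h₂⟩ :=
    WSNodalMap.exists_nbhds_reparam_notMem f₂ f₁
  -- Both conclusions survive shrinking the neighbourhoods, so the intersections serve the two
  -- directions at once.
  exact ⟨U₁ ∩ U₁', U₂ ∩ U₂', K₁, K₂, hU₁.inter hU₁', ⟨hf₁, hf₁'⟩, hU₂.inter hU₂', ⟨hf₂, hf₂'⟩,
    hK₁, hK₂, fun h hh g hg hgh => h₁ h hh.1 g hg hgh.1,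
    fun h hh g hg hgh => h₂ h hh.2 g hg hgh.2⟩
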